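/- Let $\mathbb{N}=\{1,2,3,\dots\}$, let $T_n$ be the Chebyshev polynomial of the first kind of degree $n$ (so $T_n(\cos\theta)=\cos n\theta$), and for $n,k\in\mathbb{N}$ with $n\ge k+2$ let $\omega_{n,k}$ be the rightmost zero of $T_n^{(k+1)}$ and $$\tau_{n,k}:=\frac{|T_n^{(k)}(\omega_{n,k})|}{T_n^{(k)}(1)}.$$ Then for all $n,k\in\mathbb{N}$ with $n\ge k+2$, $$\tau_{n,k}^2\;\le\;\frac12\Big(1+\frac kn\Big)\Big(\frac nk\Big)^{2k}\binom{n+k}{n-k}^{-1}\;\le\;\frac{e^2}{2\sqrt{\pi}}\,k^{1/2}\Big(1-\frac{k^2}{n^2}\Big)^{1/2}\frac{(2n)^{2k}(n-k)^{n-k}}{(n+k)^{n+k}}.$$ -/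

import Mathlib

open Polynomial

/-- `chebyshevOmega n k` is the rightmost zero `ω_{n,k}` of `T_n^{(k+1)}`, where `T_n` is the
Chebyshev polynomial of the first kind of degree `n`. It is a maximum whenever `k + 2 ≤ n`
(see `isGreatest_chebyshevOmega`). -/
noncomputable def chebyshevOmega (n k : ℕ) : ℝ :=
  sSup {x : ℝ | (derivative^[k + 1] (Chebyshev.T ℝ n)).eval x = 0}

/-- `chebyshevTau n k` is `τ_{n,k} = |T_n^{(k)}(ω_{n,k})| / T_n^{(k)}(1)`. -/
noncomputable def chebyshevTau (n k : ℕ) : ℝ :=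
  |(derivative^[k] (Chebyshev.T ℝ n)).eval (chebyshevOmega n k)| /
    (derivative^[k] (Chebyshev.T ℝ n)).eval 1

/-- The denominator in `chebyshevTau` is positive. -/
theorem eval_one_iterate_derivative_chebyshevT_pos {n k : ℕ} (h : k ≤ n) :
    0 < (derivative^[k] (Chebyshev.T ℝ n)).eval 1 := by
  rw [Chebyshev.iterate_derivative_T_eval_one_eq_div]
  refine div_pos ?_ (by positivity)
  have hpos : ∀ l ∈ Finset.range k, (0 : ℝ) < (n : ℝ) ^ 2 - (l : ℝ) ^ 2 := by
    intro l hl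
    have hlt : (l : ℝ) < n := by
      exact_mod_cast lt_of_lt_of_le (Finset.mem_range.mp hl) h
    have h0 : (0 : ℝ) ≤ l := Nat.cast_nonneg l
    nlinarith
  have := Finset.prod_pos hpos
  push_cast
  exact this

/-- For `k + 2 ≤ n` the polynomial `T_n^{(k+1)}` has a largest real zero, and it is
`chebyshevOmega n k`. -/
theorem isGreatest_chebyshevOmega {n k : ℕ} (h : k + 2 ≤ n) :
    IsGreatest {x : ℝ | (derivative^[k + 1] (Chebyshev.T ℝ n)).eval x = 0}
      (chebyshevOmega n k) := by
  have hcard : ∀ j, n ≤ (derivative^[j] (Chebyshev.T ℝ n)).roots.card + j := by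
    intro j
    induction j with
    | zero =>
      rw [Function.iterate_zero, id, Chebyshev.roots_T_real, Finset.card_val,
        Finset.card_image_of_injOn
          ((Finset.range n).nodup_map_iff_injOn.mp (Chebyshev.roots_T_real_nodup n)),
        Finset.card_range]
      omega
    | succ j ih =>
      have := card_roots_le_derivative (derivative^[j] (Chebyshev.T ℝ n))
      rw [Function.iterate_succ_apply']
      omega
  have hne : derivative^[k + 1] (Chebyshev.T ℝ n) ≠ 0 := by
    intro h0
    have := eval_one_iterate_derivative_chebyshevT_pos (n := n) (k := k + 1) (by omega)
    rw [h0] at this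
    simp at this
  have hset : {x : ℝ | (derivative^[k + 1] (Chebyshev.T ℝ n)).eval x = 0} =
      ((derivative^[k + 1] (Chebyshev.T ℝ n)).roots.toFinset : Set ℝ) := by
    ext x
    simp [mem_roots hne, IsRoot.def, -Function.iterate_succ]
  have hnonempty : (derivative^[k + 1] (Chebyshev.T ℝ n)).roots.toFinset.Nonempty := by
    rw [Multiset.toFinset_nonempty]
    intro h0
    have := hcard (k + 1)
    rw [h0, Multiset.card_zero] at this
    omega
  unfold chebyshevOmega
  rw [hset]
  have hfin := ((derivative^[k + 1] (Chebyshev.T ℝ n)).roots.toFinset).finite_toSet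
  exact ⟨Set.Nonempty.csSup_mem (by exact_mod_cast hnonempty) hfin,
    fun x hx => le_csSup hfin.bddAbove hx⟩

/-! Put f = T_n^{(k)} and v(θ) = sin^k θ · f(cos θ). The ultraspherical equation for f becomes v'' +
q v = 0 with q = n² − k(k−1)/sin² θ. Since q is nondecreasing on (0, π/2], so is the energy v'² + q
v², and its value at θ = π/2, i.e. x = 0, dominates (`ultraspherical_energy_le`).

At ω the derivative f' vanishes, so with s = 1 − ω² the energy is s^{k−1}((n² − k²)s + k) f(ω)². At
0 it is at most (n² − k² + k) · 2^k k! f(1), by closed forms for the derivatives at 0 and 1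
(`energy_zero_iterate_derivative_chebyshevT_le`). Sturm comparison gives s ≥ k(k+1)/n²
(`le_one_sub_sq_of_ultraspherical_zero`), and (1 + 1/k)^k ≥ 2 then produces the factor 1/2. Dividing
by f(1)² gives the first inequality; the second is Stirling's formula with explicit constants. -/

/-! ### Closed forms at 1 and 0, parity and positivity. -/

/-- The square is the diagonal term of Vandermonde's sum. -/
theorem choose_sq_le_choose_two_mul (a b : ℕ) : a.choose b ^ 2 ≤ (2 * a).choose (2 * b) := by
  rw [two_mul a, Nat.add_choose_eq, sq]
  exact Finset.single_le_sum (f := fun ij : ℕ × ℕ => a.choose ij.1 * a.choose ij.2)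
    (fun _ _ => Nat.zero_le _) (a := (b, b)) (by simp [two_mul])

theorem eval_one_iterate_derivative_chebyshevT_mul {n k : ℕ} (h : k ≤ n) :
    (derivative^[k] (Chebyshev.T ℝ n)).eval 1 * (n + k) =
      n * 2 ^ k * k.factorial * (n + k).choose (2 * k) := by
  induction k with
  | zero => simp
  | succ k ih =>
    have hrec := Chebyshev.iterate_derivative_T_eval_one_recurrence (R := ℝ) n k
    have h1 := Nat.add_one_mul_choose_eq (n + k) (2 * k + 1)
    have h2 := Nat.choose_succ_right_eq (n + k) (2 * k)
    have ih := ih (by omega)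
    obtain ⟨d, rfl⟩ := Nat.exists_eq_add_of_le h
    rw [show k + 1 + d + k - 2 * k = d + 1 by omega] at h2
    rw [show 2 * (k + 1) = 2 * k + 1 + 1 by ring,
      show k + 1 + d + (k + 1) = k + 1 + d + k + 1 by ring]
    generalize (k + 1 + d + k).choose (2 * k) = c0 at *
    generalize (k + 1 + d + k).choose (2 * k + 1) = c1 at *
    generalize (k + 1 + d + k + 1).choose (2 * k + 1 + 1) = c2 at *
    generalize (derivative^[k] (Chebyshev.T ℝ (k + 1 + d : ℕ))).eval 1 = a at *
    generalize (derivative^[k + 1] (Chebyshev.T ℝ (k + 1 + d : ℕ))).eval 1 = b at *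
    have h1' : ((k + 1 + d + k + 1 : ℕ) : ℝ) * c1 = c2 * (2 * k + 1 + 1 : ℕ) := by exact_mod_cast h1
    have h2' : (c1 : ℝ) * (2 * k + 1 : ℕ) = c0 * (d + 1 : ℕ) := by exact_mod_cast h2
    rw [Nat.factorial_succ, pow_succ]
    push_cast at *
    have hpos : (2 * (k : ℝ) + 1) ≠ 0 := by positivity
    refine mul_left_cancel₀ hpos ?_
    generalize (k.factorial : ℝ) = F at *
    generalize (2 : ℝ) ^ k = P at *
    linear_combination (2 * (k : ℝ) + d + 2) * hrec + (d + 1) * (2 * (k : ℝ) + d + 2) * ih -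
      (k + 1 + d) * P * F * (2 * k + d + 2) * h2' + (k + 1 + d) * P * F * (2 * k + 1) * h1'

theorem abs_eval_zero_iterate_derivative_chebyshevT_mul (k m : ℕ) :
    |(derivative^[k] (Chebyshev.T ℝ (2 * m + k : ℕ))).eval 0| * (2 * (m + k)) =
      (2 * m + k) * 2 ^ k * k.factorial * (m + k).choose k := by
  induction k using Nat.twoStepInduction generalizing m with
  | zero =>
    simp
  | one =>
    simp [Chebyshev.T_derivative_eq_U]
    rw [abs_of_nonneg (by positivity)]
    ring
  | more k ih0 ih1 =>
    -- The recurrence keeps the degree fixed, and 2m + (k + 2) = 2(m + 1) + k.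
    have ih := ih0 (m + 1)
    clear ih0 ih1
    have hrec := Chebyshev.iterate_derivative_T_eval_zero_recurrence (R := ℝ) (2 * m + (k + 2) : ℕ) k
    have h1 := Nat.add_one_mul_choose_eq (m + 1 + k) (k + 1)
    have h2 := Nat.choose_succ_right_eq (m + 1 + k) k
    rw [show m + 1 + k - k = m + 1 by omega] at h2
    rw [hrec, abs_mul, abs_neg, abs_of_nonneg (by push_cast; nlinarith [Nat.cast_nonneg (α := ℝ) m, Nat.cast_nonneg (α := ℝ) k] )]
    rw [show 2 * (m + 1) + k = 2 * m + (k + 2) by ring] at ih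
    rw [show m + (k + 2) = m + 1 + k + 1 by ring, show k + 2 = k + 1 + 1 by ring]
    rw [show 2 * m + (k + 2) = 2 * m + (k + 1 + 1) by ring] at ih
    generalize (m + 1 + k).choose k = c0 at *
    generalize (m + 1 + k).choose (k + 1) = c1 at *
    generalize (m + 1 + k + 1).choose (k + 1 + 1) = c2 at *
    generalize |(derivative^[k] (Chebyshev.T ℝ (2 * m + (k + 1 + 1) : ℕ))).eval 0| = a at *
    have h1' : ((m + 1 + k + 1 : ℕ) : ℝ) * c1 = c2 * (k + 1 + 1 : ℕ) := by exact_mod_cast h1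
    have h2' : (c1 : ℝ) * (k + 1 : ℕ) = c0 * (m + 1 : ℕ) := by exact_mod_cast h2
    rw [Nat.factorial_succ, Nat.factorial_succ, pow_succ, pow_succ]
    push_cast at *
    generalize (k.factorial : ℝ) = F at *
    linear_combination 4 * ((m : ℝ) + 1) * (m + k + 2) * ih -
      4 * (2 * m + k + 2) * 2 ^ k * F * (m + k + 2) * h2' + 4 * (2 * m + k + 2) * 2 ^ k * F * (k + 1) * h1'

theorem iterate_derivative_chebyshevT_eval_neg (n j : ℕ) (x : ℝ) :
    (derivative^[j] (Chebyshev.T ℝ n)).eval (-x) =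
      (-1) ^ (n + j) * (derivative^[j] (Chebyshev.T ℝ n)).eval x := by
  have key : (derivative^[j] (Chebyshev.T ℝ n)).comp (-X) =
      (-1) ^ (n + j) * derivative^[j] (Chebyshev.T ℝ n) := by
    induction j with
    | zero =>
      refine Polynomial.funext fun y => ?_
      simp [Chebyshev.T_eval_neg]
    | succ j ih =>
      have h := congrArg derivative ih
      rw [derivative_comp, ← Function.iterate_succ_apply' derivative] at h
      have h3 : derivative ((-1 : ℝ[X]) ^ (n + j) * derivative^[j] (Chebyshev.T ℝ n)) =
          (-1) ^ (n + j) * derivative^[j + 1] (Chebyshev.T ℝ n) := by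
        rw [Function.iterate_succ_apply']
        have : ((-1 : ℝ[X]) ^ (n + j)) = C ((-1) ^ (n + j)) := by simp
        rw [this, derivative_C_mul]
      rw [h3] at h
      rw [← add_assoc, pow_succ]
      simp only [derivative_neg, derivative_X] at h
      linear_combination -h
  have := congrArg (eval x) key
  simpa [eval_comp, -Function.iterate_succ] using this

theorem iterate_derivative_chebyshevT_eval_pos {n j : ℕ} (hj : j ≤ n) {x : ℝ} (hx : 1 ≤ x) :
    0 < (derivative^[j] (Chebyshev.T ℝ n)).eval x := by
  -- Descend from the vanishing derivative of order n + 1: each lower one is monotone on [1, ∞) and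
  -- positive at 1.
  have key : ∀ d j, j + d = n + 1 → ∀ x : ℝ, 1 ≤ x →
      0 ≤ (derivative^[j] (Chebyshev.T ℝ n)).eval x ∧
        (j ≤ n → (derivative^[j] (Chebyshev.T ℝ n)).eval 1 ≤
          (derivative^[j] (Chebyshev.T ℝ n)).eval x) := by
    intro d
    induction d with
    | zero =>
      intro j hj x _
      rw [iterate_derivative_eq_zero (by rw [Chebyshev.natDegree_T]; simp; omega)]
      simp
    | succ d ih =>
      intro j hj x hx
      have hmono : MonotoneOn (fun y => (derivative^[j] (Chebyshev.T ℝ n)).eval y) (Set.Ici 1) := by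
        refine monotoneOn_of_deriv_nonneg (convex_Ici 1) (Polynomial.continuous _).continuousOn
          (Polynomial.differentiable _).differentiableOn fun y hy => ?_
        rw [interior_Ici] at hy
        rw [Polynomial.deriv, ← Function.iterate_succ_apply' (f := derivative)]
        exact (ih (j + 1) (by omega) y (le_of_lt hy)).1
      have h1 := hmono (Set.mem_Ici.2 le_rfl) (Set.mem_Ici.2 hx) hx
      have h0 := eval_one_iterate_derivative_chebyshevT_pos (show j ≤ n by omega)
      exact ⟨h0.le.trans h1, fun _ => h1⟩
  have h0 := eval_one_iterate_derivative_chebyshevT_pos hj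
  exact h0.trans_le ((key (n + 1 - j) j (by omega) x hx).2 hj)

/-! ### The Stirling estimate. -/

theorem half_mul_choose_inv_le_stirling {n k : ℕ} (hk : 1 ≤ k) (hn : k + 1 ≤ n) :
    1 / 2 * (1 + (k : ℝ) / n) * ((n : ℝ) / k) ^ (2 * k) *
          ((Nat.choose (n + k) (n - k) : ℕ) : ℝ)⁻¹ ≤
        Real.exp 1 ^ 2 / (2 * Real.sqrt Real.pi) * Real.sqrt (k : ℝ) *
          Real.sqrt (1 - (k : ℝ) ^ 2 / (n : ℝ) ^ 2) *
          ((2 * (n : ℝ)) ^ (2 * k) * ((n : ℝ) - k) ^ (n - k) / ((n : ℝ) + k) ^ (n + k)) := by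
  obtain ⟨d, rfl⟩ := Nat.exists_eq_add_of_le (show k ≤ n by omega)
  have hd : 1 ≤ d := by omega
  have hk0 : (0 : ℝ) < k := by exact_mod_cast hk
  have hd0 : (0 : ℝ) < d := by exact_mod_cast hd
  have hfac : ∀ N : ℕ, 1 ≤ N → (N.factorial : ℝ) =
      Stirling.stirlingSeq N * (√(2 * N : ℝ) * (N / Real.exp 1) ^ N) := by
    intro N hN
    have : (0 : ℝ) < N := by exact_mod_cast hN
    rw [Stirling.stirlingSeq, div_mul_cancel₀]
    positivity
  -- The Stirling sequence decreases from e/√2 at N = 1 and stays above √π; two upper bounds and one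
  -- lower bound give e²/(2√π).
  have hupper : ∀ N : ℕ, 1 ≤ N → Stirling.stirlingSeq N ≤ Real.exp 1 / √2 := by
    intro N hN
    obtain ⟨M, rfl⟩ := Nat.exists_eq_add_of_le' hN
    have := Stirling.stirlingSeq'_antitone (Nat.zero_le M)
    simpa using this
  have hpos : ∀ N : ℕ, 1 ≤ N → 0 < Stirling.stirlingSeq N := by
    intro N hN
    obtain ⟨M, rfl⟩ := Nat.exists_eq_add_of_le' hN
    exact Stirling.stirlingSeq'_pos M
  have hchoose : (((k + d + k).choose (k + d - k) : ℕ) : ℝ)⁻¹ =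
      (d.factorial * (2 * k).factorial : ℝ) / (k + d + k).factorial := by
    rw [show k + d - k = d by omega, show k + d + k = d + 2 * k by ring, Nat.cast_add_choose,
      inv_div]
  have hratio : Stirling.stirlingSeq d * Stirling.stirlingSeq (2 * k) /
      Stirling.stirlingSeq (k + d + k) ≤ Real.exp 1 ^ 2 / (2 * √Real.pi) := by
    have hlow := Stirling.sqrt_pi_le_stirlingSeq (n := k + d + k) (by omega)
    have hpi : 0 < √Real.pi := Real.sqrt_pos.2 Real.pi_pos
    have hnum : Stirling.stirlingSeq d * Stirling.stirlingSeq (2 * k) ≤ Real.exp 1 ^ 2 / 2 := by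
      calc _ ≤ (Real.exp 1 / √2) * (Real.exp 1 / √2) :=
            mul_le_mul (hupper d hd) (hupper _ (by omega)) (hpos _ (by omega)).le (by positivity)
        _ = Real.exp 1 ^ 2 / 2 := by
            rw [div_mul_div_comm, Real.mul_self_sqrt (by norm_num), sq]
    calc _ ≤ (Real.exp 1 ^ 2 / 2) / √Real.pi := by gcongr
      _ = _ := by rw [div_div]
  have hsqrt : √(1 - (k : ℝ) ^ 2 / ((k + d : ℕ) : ℝ) ^ 2) = √d * √(k + d + k) / (k + d) := by
    rw [← Real.sqrt_mul hd0.le, eq_div_iff (by positivity), ← sq_eq_sq₀ (by positivity)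
      (by positivity), mul_pow, Real.sq_sqrt, Real.sq_sqrt (by positivity)]
    · push_cast; field_simp; ring
    · rw [sub_nonneg, div_le_one (by positivity)]
      push_cast
      nlinarith
  have hmain : 1 / 2 * (1 + (k : ℝ) / (k + d : ℕ)) * (((k + d : ℕ) : ℝ) / k) ^ (2 * k) *
      (((k + d + k).choose (k + d - k) : ℕ) : ℝ)⁻¹ =
      Stirling.stirlingSeq d * Stirling.stirlingSeq (2 * k) / Stirling.stirlingSeq (k + d + k) *
        √k * √(1 - (k : ℝ) ^ 2 / ((k + d : ℕ) : ℝ) ^ 2) *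
        ((2 * ((k + d : ℕ) : ℝ)) ^ (2 * k) * (((k + d : ℕ) : ℝ) - k) ^ (k + d - k) /
          (((k + d : ℕ) : ℝ) + k) ^ (k + d + k)) := by
    rw [hchoose, hsqrt, hfac d hd, hfac (2 * k) (by omega), hfac (k + d + k) (by omega),
      show k + d - k = d by omega]
    have h1 := hpos d hd
    have h2 := hpos (2 * k) (by omega)
    have h3 := hpos (k + d + k) (by omega)
    generalize Stirling.stirlingSeq d = a at *
    generalize Stirling.stirlingSeq (2 * k) = b at *
    generalize Stirling.stirlingSeq (k + d + k) = c at *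
    push_cast
    rw [show (2 * (2 * (k : ℝ))) = 2 ^ 2 * k by ring, Real.sqrt_mul (by positivity) (k : ℝ),
      Real.sqrt_sq (by norm_num), Real.sqrt_mul (by norm_num) (d : ℝ),
      Real.sqrt_mul (by norm_num) ((k : ℝ) + d + k), show (k : ℝ) + d - k = d by ring]
    have he := Real.exp_pos 1
    generalize Real.exp 1 = e at *
    have hs := Real.mul_self_sqrt (show (0 : ℝ) ≤ k + d + k by positivity)
    have hs0 : 0 < √((k : ℝ) + d + k) := Real.sqrt_pos.2 (by positivity)
    have h20 : 0 < √(2 : ℝ) := by positivity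
    generalize √(2 : ℝ) = r at *
    generalize √(d : ℝ) = rd at *
    generalize √(k : ℝ) = rk at *
    have hN : (k : ℝ) + d + k ≠ 0 := by positivity
    have hN' : (k : ℝ) + d ≠ 0 := by positivity
    simp only [div_pow, mul_pow]
    rw [show e ^ (k + d + k) = e ^ d * e ^ (2 * k) by rw [← pow_add]; ring_nf]
    generalize √((k : ℝ) + d + k) = rn at *
    field_simp
    rw [← hs]
    ring
  rw [hmain]
  gcongr
  push_cast
  rw [add_sub_cancel_left]
  positivity

/-! ### Energy and Sturm comparison for ultraspherical equations. -/

theorem hasDerivAt_eval_iterate_derivative (p : ℝ[X]) (j : ℕ) (y : ℝ) :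
    HasDerivAt (fun y => (derivative^[j] p).eval y) ((derivative^[j + 1] p).eval y) y := by
  rw [Function.iterate_succ_apply' derivative]
  exact Polynomial.hasDerivAt _ y

/-- The energy of a solution `f` of an ultraspherical differential equation is maximal at `0`. -/
theorem ultraspherical_energy_le {f g h : ℝ → ℝ} {A : ℝ} {p : ℕ}
    (hf : ∀ y, HasDerivAt f (g y) y) (hg : ∀ y, HasDerivAt g (h y) y)
    (hode : ∀ y, (1 - y ^ 2) * h y = (2 * p + 3) * y * g y - A * f y)
    {x : ℝ} (hx0 : 0 ≤ x) (hx1 : x < 1) :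
    (1 - x ^ 2) ^ p * ((A * (1 - x ^ 2) + (p + 1)) * f x ^ 2 -
        2 * (p + 1) * x * (1 - x ^ 2) * f x * g x + (1 - x ^ 2) ^ 2 * g x ^ 2) ≤
      (A + (p + 1)) * f 0 ^ 2 + g 0 ^ 2 := by
  -- This is v'² + q v² written in x = cos θ, with p = k − 1.
  let H : ℝ → ℝ := fun x => (1 - x ^ 2) ^ p * ((A * (1 - x ^ 2) + (p + 1)) * f x ^ 2 -
        2 * (p + 1) * x * (1 - x ^ 2) * f x * g x + (1 - x ^ 2) ^ 2 * g x ^ 2)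
  have hs : ∀ y : ℝ, HasDerivAt (fun y : ℝ => 1 - y ^ 2) (-(2 * y)) y := fun y => by
    simpa using (hasDerivAt_pow 2 y).const_sub 1
  have hH : ∀ y, HasDerivAt H (-(2 * (p + 1) * p * y * (1 - y ^ 2) ^ (p - 1) * f y ^ 2)) y := by
    intro y
    have ode := hode y
    have hd := ((hs y).pow p).mul (((((((hs y).const_mul A).add_const
      ((p : ℝ) + 1)).mul ((hf y).pow 2))).sub (((((hasDerivAt_id y).const_mul
        (2 * ((p : ℝ) + 1))).mul (hs y)).mul (hf y)).mul (hg y))).add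
          (((hs y).pow 2).mul ((hg y).pow 2)))
    refine hd.congr_deriv ?_
    simp only [Pi.add_apply, Pi.mul_apply, Pi.sub_apply, Pi.pow_apply, id]
    generalize f y = a at *
    generalize g y = b at *
    generalize h y = c at *
    -- For p = 0 the exponent p − 1 truncates, but the factor p kills that term.
    rcases p with _ | q
    · simp
      push_cast at ode
      linear_combination (-2 * y * a + 2 * (1 - y ^ 2) * b) * ode
    · rw [pow_succ (1 - y ^ 2) q, Nat.add_sub_cancel]
      push_cast at *
      generalize (1 - y ^ 2) ^ q = S
      linear_combination S * (1 - y ^ 2) * (-2 * (q + 2) * y * a + 2 * (1 - y ^ 2) * b) * ode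
  have hanti : AntitoneOn H (Set.Icc 0 x) := by
    refine antitoneOn_of_deriv_nonpos (convex_Icc 0 x)
      (fun y _ => (hH y).continuousAt.continuousWithinAt)
      (fun y _ => (hH y).differentiableAt.differentiableWithinAt) fun y hy => ?_
    rw [interior_Icc] at hy
    rw [(hH y).deriv, neg_nonpos]
    have h1 : 0 ≤ 1 - y ^ 2 := by nlinarith [hy.1, hy.2]
    have h2 := hy.1.le
    positivity
  simpa [H] using hanti (Set.left_mem_Icc.2 hx0) (Set.right_mem_Icc.2 hx0) hx0

/-- Sturm comparison: the last zero of a solution `g` of an ultraspherical differential equation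
stays away from `1`. -/
theorem le_one_sub_sq_of_ultraspherical_zero {g h l : ℝ → ℝ} {N : ℝ} {k : ℕ} (hk : 1 ≤ k)
    (hg : ∀ y, HasDerivAt g (h y) y) (hh : ∀ y, HasDerivAt h (l y) y)
    (hode : ∀ y, (1 - y ^ 2) * l y = (2 * k + 3) * y * h y - (N ^ 2 - (k + 1) ^ 2) * g y)
    {w : ℝ} (hw0 : 0 ≤ w) (hw1 : w < 1) (hgw : g w = 0) (hpos : ∀ y, w < y → y ≤ 1 → 0 < g y) :
    (k : ℝ) * (k + 1) ≤ N ^ 2 * (1 - w ^ 2) := by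
  by_contra! hlt
  have hcos : Real.cos (Real.arccos w) = w := Real.cos_arccos (by linarith) hw1.le
  set t := Real.arccos w
  have ht0 : 0 < t := Real.arccos_pos.2 hw1
  have htpi : t ≤ Real.pi / 2 := Real.arccos_le_pi_div_two.2 hw0
  have hcosmem : ∀ u, 0 < u → u < t → w < Real.cos u ∧ Real.cos u ≤ 1 := fun u h0 h1 =>
    ⟨hcos ▸ Real.cos_lt_cos_of_nonneg_of_le_pi_div_two h0.le htpi h1, Real.cos_le_one u⟩
  have hsinpos : ∀ u, 0 < u → u < t → 0 < Real.sin u := fun u h0 h1 =>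
    Real.sin_pos_of_pos_of_lt_pi h0 (by linarith [Real.pi_pos])
  -- V is the derivative of v = sin^{k+1} u · g(cos u), which solves v'' = (k(k+1)/sin² u − N²) v.
  -- If the claim fails, v is strictly convex on [0, t].
  let V : ℝ → ℝ := fun u => Real.sin u ^ k *
    ((k + 1) * Real.cos u * g (Real.cos u) - Real.sin u ^ 2 * h (Real.cos u))
  have hv : ∀ u, HasDerivAt (fun u => Real.sin u ^ (k + 1) * g (Real.cos u)) (V u) u := by
    intro u
    refine (((Real.hasDerivAt_sin u).pow (k + 1)).mul
      ((hg _).comp u (Real.hasDerivAt_cos u))).congr_deriv ?_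
    simp only [V, Pi.pow_apply, Function.comp, Nat.add_sub_cancel]
    push_cast
    ring
  have hV : ∀ u, HasDerivAt V
      (Real.sin u ^ (k - 1) * (k * (k + 1) - N ^ 2 * Real.sin u ^ 2) * g (Real.cos u)) u := by
    intro u
    have ode := hode (Real.cos u)
    refine (((Real.hasDerivAt_sin u).pow k).mul ((((Real.hasDerivAt_cos u).const_mul
      ((k : ℝ) + 1)).mul ((hg _).comp u (Real.hasDerivAt_cos u))).sub
        (((Real.hasDerivAt_sin u).pow 2).mul
          ((hh _).comp u (Real.hasDerivAt_cos u))))).congr_deriv ?_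
    simp only [Pi.mul_apply, Pi.sub_apply, Pi.pow_apply, Function.comp]
    obtain ⟨q, rfl⟩ := Nat.exists_eq_add_of_le' hk
    rw [pow_succ (Real.sin u) q, Nat.add_sub_cancel]
    have hsc := Real.sin_sq_add_cos_sq u
    generalize g (Real.cos u) = a at *
    generalize h (Real.cos u) = b at *
    generalize l (Real.cos u) = c at *
    generalize Real.sin u ^ q = S
    generalize Real.cos u = x at *
    generalize Real.sin u = y at *
    push_cast at *
    linear_combination S * y ^ 2 * ode + S * y ^ 2 * c * hsc + S * a * (q + 1) * (q + 2) * hsc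
  have hVmono : StrictMonoOn V (Set.Icc 0 t) := by
    refine strictMonoOn_of_deriv_pos (convex_Icc 0 t)
      (fun y _ => (hV y).continuousAt.continuousWithinAt) fun u hu => ?_
    rw [interior_Icc] at hu
    rw [(hV u).deriv]
    obtain ⟨h1, h2⟩ := hcosmem u hu.1 hu.2
    have h3 : N ^ 2 * Real.sin u ^ 2 ≤ N ^ 2 * (1 - w ^ 2) := by
      rw [Real.sin_sq]
      gcongr
    exact mul_pos (mul_pos (pow_pos (hsinpos u hu.1 hu.2) _) (by linarith)) (hpos _ h1 h2)
  -- v vanishes at 0 and t, so Rolle gives V(c) = 0, against V(0) = 0 and strict growth of V.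
  obtain ⟨c, hc, hVc⟩ := exists_hasDerivAt_eq_zero ht0
    (fun y _ => (hv y).continuousAt.continuousWithinAt) (by simp [hcos, hgw]) fun u _ => hv u
  have := hVmono (Set.left_mem_Icc.2 ht0.le) ⟨hc.1.le, hc.2.le⟩ hc.1
  rw [hVc] at this
  simp [V, show k ≠ 0 by omega] at this

/-! ### Location of the rightmost zero. -/

theorem chebyshevOmega_nonneg {n k : ℕ} (h : k + 2 ≤ n) : 0 ≤ chebyshevOmega n k := by
  have hg := isGreatest_chebyshevOmega h
  have h1 : (derivative^[k + 1] (Chebyshev.T ℝ n)).eval (chebyshevOmega n k) = 0 := hg.1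
  have h2 : -chebyshevOmega n k ≤ chebyshevOmega n k := hg.2 (by
    rw [Set.mem_ofPred_eq, iterate_derivative_chebyshevT_eval_neg, h1, mul_zero])
  linarith

theorem chebyshevOmega_lt_one {n k : ℕ} (h : k + 2 ≤ n) : chebyshevOmega n k < 1 := by
  by_contra! h1
  exact (iterate_derivative_chebyshevT_eval_pos (j := k + 1) (by omega) h1).ne'
    (isGreatest_chebyshevOmega h).1

theorem iterate_derivative_chebyshevT_eval_pos_of_omega_lt {n k : ℕ} (h : k + 2 ≤ n) {x : ℝ}
    (hx : chebyshevOmega n k < x) : 0 < (derivative^[k + 1] (Chebyshev.T ℝ n)).eval x := by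
  rcases le_total 1 x with h1 | h1
  · exact iterate_derivative_chebyshevT_eval_pos (by omega) h1
  by_contra! hneg
  have hone := iterate_derivative_chebyshevT_eval_pos (n := n) (j := k + 1) (by omega) le_rfl
  obtain ⟨y, hy, hy0⟩ := intermediate_value_Icc h1
    (Polynomial.continuous (derivative^[k + 1] (Chebyshev.T ℝ n))).continuousOn ⟨hneg, hone.le⟩
  have := (isGreatest_chebyshevOmega h).2 hy0
  linarith [hy.1]

theorem mul_succ_le_sq_mul_one_sub_chebyshevOmega_sq {n k : ℕ} (hk : 1 ≤ k) (h : k + 2 ≤ n) :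
    (k : ℝ) * (k + 1) ≤ (n : ℝ) ^ 2 * (1 - chebyshevOmega n k ^ 2) := by
  refine le_one_sub_sq_of_ultraspherical_zero hk
    (hasDerivAt_eval_iterate_derivative (Chebyshev.T ℝ n) (k + 1))
    (hasDerivAt_eval_iterate_derivative (Chebyshev.T ℝ n) (k + 1 + 1)) (fun y => ?_)
    (chebyshevOmega_nonneg h) (chebyshevOmega_lt_one h) (isGreatest_chebyshevOmega h).1
    fun y hy _ => iterate_derivative_chebyshevT_eval_pos_of_omega_lt h hy
  have := Chebyshev.one_sub_X_sq_mul_iterate_derivative_T_eval (R := ℝ) n (k + 1) y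
  push_cast at this
  linear_combination this

/-! ### The energy at 0. -/

theorem iterate_derivative_chebyshevT_eval_zero_of_odd {n j : ℕ} (h : Odd (n + j)) :
    (derivative^[j] (Chebyshev.T ℝ n)).eval 0 = 0 := by
  have := iterate_derivative_chebyshevT_eval_neg n j 0
  rw [neg_zero, h.neg_one_pow] at this
  linarith

theorem sq_eval_zero_iterate_derivative_chebyshevT_le {k : ℕ} (hk : 1 ≤ k) (m : ℕ) :
    (derivative^[k] (Chebyshev.T ℝ (2 * m + k : ℕ))).eval 0 ^ 2 ≤
      2 ^ k * k.factorial * (derivative^[k] (Chebyshev.T ℝ (2 * m + k : ℕ))).eval 1 := by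
  have h0 := abs_eval_zero_iterate_derivative_chebyshevT_mul k m
  have h1 := eval_one_iterate_derivative_chebyshevT_mul (n := 2 * m + k) (k := k) (by omega)
  have hc : (((m + k).choose k : ℕ) : ℝ) ^ 2 ≤ ((2 * m + k + k).choose (2 * k) : ℕ) := by
    rw [show 2 * m + k + k = 2 * (m + k) by ring]
    exact_mod_cast choose_sq_le_choose_two_mul (m + k) k
  rw [← sq_abs]
  generalize |(derivative^[k] (Chebyshev.T ℝ (2 * m + k : ℕ))).eval 0| = a at *
  generalize (derivative^[k] (Chebyshev.T ℝ (2 * m + k : ℕ))).eval 1 = b at *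
  generalize (((m + k).choose k : ℕ) : ℝ) = c at *
  generalize (((2 * m + k + k).choose (2 * k) : ℕ) : ℝ) = C at *
  have hk0 : (0 : ℝ) < k := by exact_mod_cast hk
  push_cast at h1
  set P : ℝ := 2 ^ k * k.factorial
  have hS : (0 : ℝ) < 2 * (m + k) := by positivity
  refine le_of_mul_le_mul_right ?_ (pow_pos hS 2)
  calc a ^ 2 * (2 * (m + k)) ^ 2 = (2 * m + k) * (2 * m + k) * P ^ 2 * c ^ 2 := by
        rw [← mul_pow, h0]; ring
    _ ≤ (2 * (m + k)) * (2 * m + k) * P ^ 2 * C := by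
        gcongr
        linarith
    _ = P * b * (2 * (m + k)) ^ 2 := by
        linear_combination -(2 * (m + k)) * P * h1

theorem sq_eval_zero_iterate_derivative_succ_chebyshevT_le {k : ℕ} (m : ℕ) :
    (derivative^[k + 1] (Chebyshev.T ℝ (2 * m + (k + 1) : ℕ))).eval 0 ^ 2 ≤
      (((2 * m + (k + 1) : ℕ) : ℝ) ^ 2 - k ^ 2 + k) *
      (2 ^ k * k.factorial * (derivative^[k] (Chebyshev.T ℝ (2 * m + (k + 1) : ℕ))).eval 1) := by
  have h0 := abs_eval_zero_iterate_derivative_chebyshevT_mul (k + 1) m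
  have h1 := eval_one_iterate_derivative_chebyshevT_mul (n := 2 * m + (k + 1)) (k := k) (by omega)
  have hc : (((m + k).choose k : ℕ) : ℝ) ^ 2 ≤ ((2 * m + 2 * k).choose (2 * k) : ℕ) := by
    rw [show 2 * m + 2 * k = 2 * (m + k) by ring]
    exact_mod_cast choose_sq_le_choose_two_mul (m + k) k
  have h2 : ((m + k + 1 : ℕ) : ℝ) * (m + k).choose k = (m + k + 1).choose (k + 1) * (k + 1 : ℕ) := by
    exact_mod_cast Nat.add_one_mul_choose_eq (m + k) k
  have h3 : (((2 * m + 2 * k).choose (2 * k) : ℕ) : ℝ) * (2 * m + 2 * k + 1 : ℕ) =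
      (2 * m + 2 * k + 1).choose (2 * k) * (2 * m + 1 : ℕ) := by
    have := Nat.choose_mul_succ_eq (2 * m + 2 * k) (2 * k)
    rw [show 2 * m + 2 * k + 1 - 2 * k = 2 * m + 1 by omega] at this
    exact_mod_cast this
  rw [show 2 * m + (k + 1) + k = 2 * m + 2 * k + 1 by ring] at h1
  rw [← add_assoc, Nat.factorial_succ] at h0
  rw [← add_assoc m k 1, pow_succ] at h0
  have hb := eval_one_iterate_derivative_chebyshevT_pos (show k ≤ 2 * m + (k + 1) by omega)
  rw [← sq_abs]
  rw [← add_assoc] at h1 hb ⊢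
  generalize |(derivative^[k + 1] (Chebyshev.T ℝ (2 * m + k + 1 : ℕ))).eval 0| = a at *
  generalize (derivative^[k] (Chebyshev.T ℝ (2 * m + k + 1 : ℕ))).eval 1 = b at *
  generalize (((m + k).choose k : ℕ) : ℝ) = c at *
  generalize (((m + k + 1).choose (k + 1) : ℕ) : ℝ) = c' at *
  generalize (((2 * m + 2 * k).choose (2 * k) : ℕ) : ℝ) = C at *
  generalize (((2 * m + 2 * k + 1).choose (2 * k) : ℕ) : ℝ) = C' at *
  push_cast at *
  have hP : (0 : ℝ) < 2 ^ k * k.factorial := by positivity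
  generalize hPdef : (2 : ℝ) ^ k * k.factorial = P at *
  have ha : a = (2 * m + k + 1) * P * c := by
    have hS : (2 * ((m : ℝ) + k + 1)) ≠ 0 := by positivity
    refine mul_right_cancel₀ hS ?_
    rw [← hPdef]
    linear_combination h0 - 2 * (2 * m + k + 1) * 2 ^ k * k.factorial * h2
  have hKb : P * b * (2 * m + 1) = (2 * m + k + 1) * P ^ 2 * C := by
    have hS : (2 * (m : ℝ) + 2 * k + 1) ≠ 0 := by positivity
    refine mul_right_cancel₀ hS ?_
    rw [← hPdef]
    linear_combination (2 * m + 1) * 2 ^ k * k.factorial * h1 -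
      (2 * m + k + 1) * (2 ^ k * k.factorial) ^ 2 * h3
  calc a ^ 2 = (2 * m + k + 1) * ((2 * m + k + 1) * P ^ 2 * c ^ 2) := by rw [ha]; ring
    _ ≤ (2 * m + k + 1) * ((2 * m + k + 1) * P ^ 2 * C) := by gcongr
    _ = ((2 * m + k + 1) * (2 * m + 1)) * (P * b) := by rw [← hKb]; ring
    -- With n = 2m + k + 1 this is n(n − k) ≤ n² − k² + k.
    _ ≤ ((2 * m + k + 1) ^ 2 - k ^ 2 + k) * (P * b) := by
      have := mul_pos hP hb
      have hk0 : (0 : ℝ) ≤ k := Nat.cast_nonneg k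
      have hm0 : (0 : ℝ) ≤ m := Nat.cast_nonneg m
      gcongr
      nlinarith [mul_nonneg hk0 hm0]

/-- By parity one of the two terms on the left vanishes, and the other is bounded by the matching
closed form. -/
theorem energy_zero_iterate_derivative_chebyshevT_le {n k : ℕ} (hk : 1 ≤ k) (h : k ≤ n) :
    ((n : ℝ) ^ 2 - k ^ 2 + k) * (derivative^[k] (Chebyshev.T ℝ n)).eval 0 ^ 2 +
        (derivative^[k + 1] (Chebyshev.T ℝ n)).eval 0 ^ 2 ≤
      ((n : ℝ) ^ 2 - k ^ 2 + k) *
        (2 ^ k * k.factorial * (derivative^[k] (Chebyshev.T ℝ n)).eval 1) := by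
  obtain ⟨d, rfl⟩ := Nat.exists_eq_add_of_le' h
  have hnk : 0 ≤ ((d + k : ℕ) : ℝ) ^ 2 - k ^ 2 + k := by
    push_cast
    ring_nf
    positivity
  rcases Nat.even_or_odd' d with ⟨m, rfl | rfl⟩
  · rw [iterate_derivative_chebyshevT_eval_zero_of_odd (j := k + 1) ⟨m + k, by ring⟩]
    have := mul_le_mul_of_nonneg_left (sq_eval_zero_iterate_derivative_chebyshevT_le hk m) hnk
    linarith
  · rw [iterate_derivative_chebyshevT_eval_zero_of_odd (j := k) ⟨m + k, by ring⟩]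
    have := sq_eval_zero_iterate_derivative_succ_chebyshevT_le (k := k) m
    rw [show 2 * m + (k + 1) = 2 * m + 1 + k by ring] at this
    linarith

/-! ### Combining the estimates. -/

theorem sq_eval_chebyshevOmega_mul_le {n k : ℕ} (hk : 1 ≤ k) (h : k + 2 ≤ n) :
    (derivative^[k] (Chebyshev.T ℝ n)).eval (chebyshevOmega n k) ^ 2 *
        (2 * ((k : ℝ) / n) ^ (2 * k)) ≤
      2 ^ k * k.factorial * (derivative^[k] (Chebyshev.T ℝ n)).eval 1 := by
  have hE0 := energy_zero_iterate_derivative_chebyshevT_le hk (show k ≤ n by omega)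
  have hs := mul_succ_le_sq_mul_one_sub_chebyshevOmega_sq hk h
  have hw : (derivative^[k + 1] (Chebyshev.T ℝ n)).eval (chebyshevOmega n k) = 0 :=
    (isGreatest_chebyshevOmega h).1
  obtain ⟨p, rfl⟩ := Nat.exists_eq_add_of_le' hk
  have hE := ultraspherical_energy_le (A := (n : ℝ) ^ 2 - (p + 1) ^ 2) (p := p)
    (hasDerivAt_eval_iterate_derivative (Chebyshev.T ℝ n) (p + 1))
    (hasDerivAt_eval_iterate_derivative (Chebyshev.T ℝ n) (p + 1 + 1)) (fun y => by
      have := Chebyshev.one_sub_X_sq_mul_iterate_derivative_T_eval (R := ℝ) n (p + 1) y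
      push_cast at this
      linear_combination this)
    (chebyshevOmega_nonneg h) (chebyshevOmega_lt_one h)
  rw [hw] at hE
  have hn : (p : ℝ) + 1 + 2 ≤ n := by exact_mod_cast h
  have hp : (0 : ℝ) ≤ p := Nat.cast_nonneg p
  push_cast at hE0 hs ⊢
  have hn0 : (0 : ℝ) < n := by linarith
  have hA : 0 < (n : ℝ) ^ 2 - (p + 1) ^ 2 := by nlinarith
  set s := 1 - chebyshevOmega n (p + 1) ^ 2
  set f := (derivative^[p + 1] (Chebyshev.T ℝ n)).eval (chebyshevOmega n (p + 1))
  set K : ℝ := 2 ^ (p + 1) * (p + 1).factorial * (derivative^[p + 1] (Chebyshev.T ℝ n)).eval 1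
  set A := (n : ℝ) ^ 2 - (p + 1) ^ 2
  have hs' : ((p : ℝ) + 1) * (p + 1 + 1) / n ^ 2 ≤ s := by
    rw [div_le_iff₀ (by positivity)]
    linarith
  set s0 := ((p : ℝ) + 1) * (p + 1 + 1) / n ^ 2 with hs0
  have hs0pos : 0 < s0 := by positivity
  have hpow : 2 * (((p : ℝ) + 1) / n) ^ (2 * (p + 1)) ≤ s0 ^ (p + 1) := by
    -- Bernoulli: (1 + 1/k)^k ≥ 2 with k = p + 1.
    have hb : 1 + ((p + 1 : ℕ) : ℝ) * (1 / ((p : ℝ) + 1)) ≤ (1 + 1 / ((p : ℝ) + 1)) ^ (p + 1) :=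
      one_add_mul_le_pow (by linarith [show 0 < 1 / ((p : ℝ) + 1) by positivity]) _
    have h2 : 1 + ((p + 1 : ℕ) : ℝ) * (1 / ((p : ℝ) + 1)) = 2 := by
      push_cast
      field_simp
      norm_num
    rw [h2] at hb
    have h3 : s0 = (1 + 1 / ((p : ℝ) + 1)) * (((p : ℝ) + 1) / n) ^ 2 := by
      rw [hs0]
      field_simp
    rw [h3, mul_pow, ← pow_mul]
    gcongr
  -- As s0 ≤ 1, this trades the energy's weight for a full power s0^k and lets A + k cancel.
  have hs0A : (A + (p + 1)) * s0 ≤ A * s0 + (p + 1) := by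
    have : s0 ≤ 1 := by
      rw [hs0, div_le_one (by positivity)]
      nlinarith
    nlinarith
  have hspos : 0 < s := hs0pos.trans_le hs'
  have hchain : (A + (p + 1)) * (f ^ 2 * (2 * (((p : ℝ) + 1) / n) ^ (2 * (p + 1)))) ≤
      (A + (p + 1)) * K := by
    calc (A + (p + 1)) * (f ^ 2 * (2 * (((p : ℝ) + 1) / n) ^ (2 * (p + 1))))
        ≤ (A + (p + 1)) * (f ^ 2 * s0 ^ (p + 1)) := by gcongr
      _ = s0 ^ p * ((A + (p + 1)) * s0) * f ^ 2 := by ring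
      _ ≤ s0 ^ p * (A * s0 + (p + 1)) * f ^ 2 := by gcongr
      _ ≤ s ^ p * (A * s + (p + 1)) * f ^ 2 := by gcongr
      _ ≤ _ := by linarith
  exact le_of_mul_le_mul_left hchain (by positivity)

theorem chebyshevTau_sq_le {n k : ℕ} (hk : 1 ≤ k) (hn : k + 2 ≤ n) :
    chebyshevTau n k ^ 2 ≤
        1 / 2 * (1 + (k : ℝ) / n) * ((n : ℝ) / k) ^ (2 * k) *
          ((Nat.choose (n + k) (n - k) : ℕ) : ℝ)⁻¹ := by
  have hmain := sq_eval_chebyshevOmega_mul_le hk hn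
  have h1 := eval_one_iterate_derivative_chebyshevT_mul (n := n) (k := k) (by omega)
  have hb := eval_one_iterate_derivative_chebyshevT_pos (n := n) (k := k) (by omega)
  have hchoose : (n + k).choose (n - k) = (n + k).choose (2 * k) :=
    Nat.choose_symm_of_eq_add (by omega)
  have hC : (0 : ℝ) < ((n + k).choose (2 * k) : ℕ) := by
    exact_mod_cast Nat.choose_pos (by omega)
  rw [chebyshevTau, hchoose, div_pow, sq_abs]
  have hk0 : (0 : ℝ) < k := by exact_mod_cast hk
  have hn0 : (0 : ℝ) < n := by exact_mod_cast (show 0 < n by omega)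
  generalize (derivative^[k] (Chebyshev.T ℝ n)).eval (chebyshevOmega n k) = f at *
  generalize (derivative^[k] (Chebyshev.T ℝ n)).eval 1 = b at *
  generalize (((n + k).choose (2 * k) : ℕ) : ℝ) = C at *
  have hq : (0 : ℝ) < ((k : ℝ) / n) ^ (2 * k) := by positivity
  rw [← inv_div (k : ℝ) n, inv_pow]
  generalize ((k : ℝ) / n) ^ (2 * k) = q at *
  have hrhs : 1 / 2 * (1 + (k : ℝ) / n) * q⁻¹ * C⁻¹ =
      (2 ^ k * k.factorial * b) / (2 * q) / b ^ 2 := by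
    field_simp
    linear_combination h1
  rw [hrhs]
  gcongr
  rwa [le_div_iff₀ (by positivity)]

theorem theoremt1p2 (n k : ℕ) (hk : 1 ≤ k) (hn : k + 2 ≤ n) :
    chebyshevTau n k ^ 2 ≤
        1 / 2 * (1 + (k : ℝ) / n) * ((n : ℝ) / k) ^ (2 * k) *
          ((Nat.choose (n + k) (n - k) : ℕ) : ℝ)⁻¹ ∧
      1 / 2 * (1 + (k : ℝ) / n) * ((n : ℝ) / k) ^ (2 * k) *
          ((Nat.choose (n + k) (n - k) : ℕ) : ℝ)⁻¹ ≤
        Real.exp 1 ^ 2 / (2 * Real.sqrt Real.pi) * Real.sqrt (k : ℝ) *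
          Real.sqrt (1 - (k : ℝ) ^ 2 / (n : ℝ) ^ 2) *
          ((2 * (n : ℝ)) ^ (2 * k) * ((n : ℝ) - k) ^ (n - k) / ((n : ℝ) + k) ^ (n + k)) :=
  ⟨chebyshevTau_sq_le hk hn, half_mul_choose_inv_le_stirling hk (by omega)⟩
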